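/- Let $M$ be a smooth manifold of dimension $m\ge 3$. For a smooth Riemannian metric $g$ on $M$ with Levi-Civita connection $\nabla$ let $R(x,y)=\nabla_x\nabla_y-\nabla_y\nabla_x-\nabla_{[x,y]}$ be the curvature operator. With respect to a $g$-orthonormal frame $\{e_i\}$ let $\rho x=\sum_k R(x,e_k)e_k$ be the Ricci operator and $\tau=\sum_i g(\rho e_i,e_i)$ the scalar curvature. The Weyl conformal curvature operator $W=W_g$ is defined by $$R(x,y)=W(x,y)-\frac{\tau}{(m-1)(m-2)}R_0(x,y)+\frac1{m-2}L(x,y),$$ where $R_0(x,y)z=g(y,z)x-g(x,z)y$ and $L(x,y)z=g(\rho y,z)x-g(\rho x,z)y+g(y,z)\rho x-g(x,z)\rho y$. The conformal Jacobi operator of $x\in T_PM$ is the endomorphism $J_W(x)\colon y\mapsto W(y,x)x$ of $T_PM$. We say that $(M,g)$ is conformally Osserman if for every $P\in M$ the eigenvalues of $J_W(x)$, counted with multiplicity, are the same for all $x\in T_PM$ with $g(x,x)=1$ (they may depend on $P$). **Theorem 1.2.** Let $g_1$ and $g_2$ be conformally equivalent Riemannian metrics on $M$, that is, $g_1=\alpha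 g_2$ for a smooth function $\alpha\colon M\to(0,\infty)$. Then $(M,g_1)$ is conformally Osserman if and only if $(M,g_2)$ is conformally Osserman. -/

import Mathlib

open scoped Manifold ContDiff

set_option maxSynthPendingDepth 3

noncomputable section

namespace ConformalGeometry

/-! ### Riemannian geometry on a vector space

`G y` is a bilinear form on the vector space `E` depending on the point `y` of `E`: the components
of a metric in a chart. -/

section Local

variable {E : Type*} [NormedAddCommGroup E] [NormedSpace ℝ E]

/-- The right-hand side of the Koszul formula for constant vector fields:
`koszul G y u v w = D_u G (v, w) + D_v G (u, w) - D_w G (u, v)` at the point `y`. -/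
def koszul (G : E → E →L[ℝ] E →L[ℝ] ℝ) (y : E) : E →L[ℝ] E →L[ℝ] E →L[ℝ] ℝ :=
  fderiv ℝ G y + (fderiv ℝ G y).flip
    - (ContinuousLinearMap.flipₗᵢ ℝ E E ℝ).toContinuousLinearEquiv.toContinuousLinearMap ∘L
        (fderiv ℝ G y).flip

theorem koszul_apply (G : E → E →L[ℝ] E →L[ℝ] ℝ) (y u v w : E) :
    koszul G y u v w
      = fderiv ℝ G y u v w + fderiv ℝ G y v u w - fderiv ℝ G y w u v := by
  simp [koszul]

/-- The Christoffel symbols: `Γ (u, v)` is the vector with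
`2 G (Γ (u, v), w) = D_u G (v, w) + D_v G (u, w) - D_w G (u, v)` for all `w`. -/
def christoffel (G : E → E →L[ℝ] E →L[ℝ] ℝ) (y : E) : E →L[ℝ] E →L[ℝ] E :=
  (1 / 2 : ℝ) • (ContinuousLinearMap.compL ℝ E (E →L[ℝ] ℝ) E (G y).inverse) ∘L koszul G y

/-- The Levi-Civita connection `∇_X Y` in a chart. -/
def chartNabla (G : E → E →L[ℝ] E →L[ℝ] ℝ) (X Y : E → E) (y : E) : E :=
  fderiv ℝ Y y (X y) + christoffel G y (X y) (Y y)

/-- The curvature operator `R (u, v) w = ∇_u ∇_v w - ∇_v ∇_u w - ∇_[u, v] w` in a chart, in terms of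
the Christoffel symbols; see `chartCurvature_eq` for the agreement of the two expressions. -/
def chartCurvature (G : E → E →L[ℝ] E →L[ℝ] ℝ) (y u v : E) : E →L[ℝ] E :=
  fderiv ℝ (christoffel G) y u v - fderiv ℝ (christoffel G) y v u
    + christoffel G y u ∘L christoffel G y v - christoffel G y v ∘L christoffel G y u

theorem christoffel_apply (G : E → E →L[ℝ] E →L[ℝ] ℝ) (y u v : E) :
    christoffel G y u v = (1 / 2 : ℝ) • (G y).inverse (koszul G y u v) := by
  simp [christoffel]

theorem christoffel_spec (G : E → E →L[ℝ] E →L[ℝ] ℝ) (y : E) (h : (G y).IsInvertible)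
    (u v w : E) :
    2 * G y (christoffel G y u v) w
      = fderiv ℝ G y u v w + fderiv ℝ G y v u w - fderiv ℝ G y w u v := by
  rw [← koszul_apply, christoffel_apply]
  have : G y ((G y).inverse (koszul G y u v)) = koszul G y u v := by
    obtain ⟨e, he⟩ := h
    rw [← he]
    simp
  simp [this]

theorem chartCurvature_eq (G : E → E →L[ℝ] E →L[ℝ] ℝ) (y : E)
    (h : DifferentiableAt ℝ (christoffel G) y) (u v w : E) :
    chartCurvature G y u v w
      = chartNabla G (fun _ => u) (chartNabla G (fun _ => v) (fun _ => w)) y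
        - chartNabla G (fun _ => v) (chartNabla G (fun _ => u) (fun _ => w)) y
        - chartNabla G (VectorField.lieBracket ℝ (fun _ => u) (fun _ => v)) (fun _ => w) y := by
  have key : ∀ a b : E, chartNabla G (fun _ => a) (chartNabla G (fun _ => b) (fun _ => w)) y
      = fderiv ℝ (christoffel G) y a b w + christoffel G y a (christoffel G y b w) := by
    intro a b
    have h1 : HasFDerivAt (fun z => christoffel G z b w)
        (((fderiv ℝ (christoffel G) y).flip b).flip w) y := by
      have := (h.hasFDerivAt.clm_apply (hasFDerivAt_const b y)).clm_apply (hasFDerivAt_const w y)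
      convert this using 1
      ext; simp
    have h2 : chartNabla G (fun _ => b) (fun _ => w) = fun z => christoffel G z b w := by
      funext z; simp [chartNabla]
    rw [h2, chartNabla, h1.fderiv]
    simp
  rw [key, key]
  simp [chartCurvature, chartNabla, VectorField.lieBracket]
  abel

end Local

/-! ### Riemannian manifolds -/

section Manifold

variable {m : ℕ} {M : Type*} [TopologicalSpace M] [ChartedSpace (EuclideanSpace ℝ (Fin m)) M]
  [IsManifold (𝓡 m) ∞ M]

/-- A smooth Riemannian metric on the `m`-dimensional manifold `M`. -/
abbrev RiemMetric (m : ℕ) (M : Type*) [TopologicalSpace M]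
    [ChartedSpace (EuclideanSpace ℝ (Fin m)) M] [IsManifold (𝓡 m) ∞ M] :=
  Bundle.ContMDiffRiemannianMetric (𝓡 m) ∞ (EuclideanSpace ℝ (Fin m))
    (fun p : M => TangentSpace (𝓡 m) p)

/-- `g₁ = α g₂` for a smooth positive function `α`. -/
def ConformallyEquivalent (g₁ g₂ : RiemMetric m M) : Prop :=
  ∃ α : M → ℝ, ContMDiff (𝓡 m) 𝓘(ℝ, ℝ) ∞ α ∧ (∀ p, 0 < α p) ∧
    ∀ (p : M) (x y : TangentSpace (𝓡 m) p), g₁.inner p x y = α p * g₂.inner p x y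

/-- The components of the metric `g` in the preferred chart `φ` at `p`: the bilinear form
`(u, v) ↦ g (dφ⁻¹ u, dφ⁻¹ v)` at the point `φ⁻¹ y`. -/
def metricInChart (g : RiemMetric m M) (p : M) (y : EuclideanSpace ℝ (Fin m)) :
    EuclideanSpace ℝ (Fin m) →L[ℝ] EuclideanSpace ℝ (Fin m) →L[ℝ] ℝ :=
  (ContinuousLinearMap.precomp ℝ
      (mfderiv 𝓘(ℝ, EuclideanSpace ℝ (Fin m)) (𝓡 m) (extChartAt (𝓡 m) p).symm y)) ∘L
    (g.inner ((extChartAt (𝓡 m) p).symm y)) ∘L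
    (mfderiv 𝓘(ℝ, EuclideanSpace ℝ (Fin m)) (𝓡 m) (extChartAt (𝓡 m) p).symm y)

theorem metricInChart_apply (g : RiemMetric m M) (p : M) (y u v : EuclideanSpace ℝ (Fin m)) :
    metricInChart g p y u v = g.inner ((extChartAt (𝓡 m) p).symm y)
      (mfderiv 𝓘(ℝ, EuclideanSpace ℝ (Fin m)) (𝓡 m) (extChartAt (𝓡 m) p).symm y u)
      (mfderiv 𝓘(ℝ, EuclideanSpace ℝ (Fin m)) (𝓡 m) (extChartAt (𝓡 m) p).symm y v) := rfl

/-- The curvature operator `R (x, y) z` of `g` at `p`, computed in the preferred chart at `p`. -/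
def curvature (g : RiemMetric m M) (p : M) :
    TangentSpace (𝓡 m) p →ₗ[ℝ] TangentSpace (𝓡 m) p →ₗ[ℝ]
      TangentSpace (𝓡 m) p →ₗ[ℝ] TangentSpace (𝓡 m) p :=
  let φ := extChartAt (𝓡 m) p
  let E := EuclideanSpace ℝ (Fin m)
  let d : TangentSpace (𝓡 m) p →ₗ[ℝ] E := (mfderiv (𝓡 m) 𝓘(ℝ, E) φ p).toLinearMap
  let d' : E →ₗ[ℝ] TangentSpace (𝓡 m) p :=
    (mfderiv 𝓘(ℝ, E) (𝓡 m) φ.symm (φ p)).toLinearMap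
  LinearMap.mk₂ ℝ
    (fun x y => d' ∘ₗ (chartCurvature (metricInChart g p) (φ p) (d x) (d y)).toLinearMap ∘ₗ d)
    (fun x x' y => by ext z; simp [chartCurvature]; module)
    (fun c x y => by ext z; simp [chartCurvature]; module)
    (fun x y y' => by ext z; simp [chartCurvature]; module)
    (fun c x y => by ext z; simp [chartCurvature]; module)

/-- At every point there is a `g`-orthonormal frame. -/
theorem exists_orthonormalFrame (g : RiemMetric m M) (p : M) :
    ∃ e : Fin m → TangentSpace (𝓡 m) p, ∀ i j, g.inner p (e i) (e j) = if i = j then 1 else 0 := by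
  let _ : NormedAddCommGroup (TangentSpace (𝓡 m) p) :=
    (g.toRiemannianMetric.toCore p).toNormedAddCommGroup
  let _ : InnerProductSpace ℝ (TangentSpace (𝓡 m) p) :=
    InnerProductSpace.ofCore (g.toRiemannianMetric.toCore p).toCore
  have : FiniteDimensional ℝ (TangentSpace (𝓡 m) p) :=
    inferInstanceAs (FiniteDimensional ℝ (EuclideanSpace ℝ (Fin m)))
  have hd : Module.finrank ℝ (TangentSpace (𝓡 m) p) = m :=
    finrank_euclideanSpace_fin (𝕜 := ℝ) (n := m)
  let b := (stdOrthonormalBasis ℝ (TangentSpace (𝓡 m) p)).reindex (finCongr hd)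
  exact ⟨b, fun i j => orthonormal_iff_ite.1 b.orthonormal i j⟩

/-- A `g`-orthonormal frame of the tangent space at `p`. -/
def orthonormalFrame (g : RiemMetric m M) (p : M) : Fin m → TangentSpace (𝓡 m) p :=
  (exists_orthonormalFrame g p).choose

/-- The Ricci operator `ρ x = ∑ k, R (x, e k) (e k)`, that is, `ρ (e i) = ∑ j, ρ_ij e_j` with
`ρ_ij = ∑ k, R_ikkj`. It does not depend on the orthonormal frame. -/
def ricci (g : RiemMetric m M) (p : M) : TangentSpace (𝓡 m) p →ₗ[ℝ] TangentSpace (𝓡 m) p :=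
  ∑ k, ((curvature g p).flip (orthonormalFrame g p k)).flip (orthonormalFrame g p k)

/-- The scalar curvature `τ = ∑ i, ρ_ii`. -/
def scalarCurvature (g : RiemMetric m M) (p : M) : ℝ :=
  ∑ i, g.inner p (ricci g p (orthonormalFrame g p i)) (orthonormalFrame g p i)

/-- `R₀ (x, y) z = g (y, z) x - g (x, z) y`. -/
def tensorR0 (g : RiemMetric m M) (p : M) (x y z : TangentSpace (𝓡 m) p) :
    TangentSpace (𝓡 m) p :=
  g.inner p y z • x - g.inner p x z • y

/-- `L (x, y) z = g (ρ y, z) x - g (ρ x, z) y + g (y, z) ρ x - g (x, z) ρ y`. -/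
def tensorL (g : RiemMetric m M) (p : M) (x y z : TangentSpace (𝓡 m) p) :
    TangentSpace (𝓡 m) p :=
  g.inner p (ricci g p y) z • x - g.inner p (ricci g p x) z • y
    + g.inner p y z • ricci g p x - g.inner p x z • ricci g p y

/-- The Weyl conformal curvature operator, `W = R - c₁ τ R₀ - c₂ L` with
`c₁ = -1 / ((m - 1) (m - 2))` and `c₂ = 1 / (m - 2)`, in dimension `m ≥ 3`. -/
def weyl (g : RiemMetric m M) (p : M) (x y z : TangentSpace (𝓡 m) p) : TangentSpace (𝓡 m) p :=
  curvature g p x y z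
    - (-1 / (((m : ℝ) - 1) * ((m : ℝ) - 2)) * scalarCurvature g p) • tensorR0 g p x y z
    - (1 / ((m : ℝ) - 2)) • tensorL g p x y z

/-- The conformal Jacobi operator `J_W (x) : y ↦ W (y, x) x`. -/
def conformalJacobi (g : RiemMetric m M) (p : M) (x : TangentSpace (𝓡 m) p) :
    Module.End ℝ (TangentSpace (𝓡 m) p) where
  toFun y := weyl g p y x x
  map_add' y y' := by
    simp only [weyl, tensorR0, tensorL, map_add, LinearMap.add_apply, add_apply]
    module
  map_smul' c y := by
    simp only [weyl, tensorR0, tensorL, map_smul, LinearMap.smul_apply,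
      smul_apply, RingHom.id_apply, smul_eq_mul]
    module

/-- `(M, g)` is conformally Osserman: at each point `p` the eigenvalues of `J_W (x)`, with their
multiplicities, are the same for all unit tangent vectors `x` at `p`. -/
def IsConformallyOsserman (g : RiemMetric m M) : Prop :=
  ∀ (p : M) (x y : TangentSpace (𝓡 m) p), g.inner p x x = 1 → g.inner p y y = 1 →
    ∀ c : ℝ, Module.finrank ℝ ((conformalJacobi g p x).eigenspace c)
      = Module.finrank ℝ ((conformalJacobi g p y).eigenspace c)

end Manifold
end ConformalGeometry

end

/-!
If `g₁ = exp (2 f) g₂`, the Levi-Civita connections differ by the tensor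
`D (u, v) = df (u) v + df (v) u - g₂ (u, v) grad f`, so that
`R₁ (u, v) - R₂ (u, v) = (∇_u D) v - (∇_v D) u + [D u, D v]`, which turns out to be a
Kulkarni–Nomizu product `g₂ ∧ A`. In dimension at least three `W = R - g ∧ S`, where `S` is the
Schouten operator, and taking traces shows that `g₁ ∧ S₁` also differs from `g₂ ∧ S₂` by `g₂ ∧ A`.
Hence `W` is a conformal invariant. Since `J_W (x)` is quadratic in `x`, passing from `g₂`-unit to
`g₁`-unit vectors multiplies all eigenvalues by the same factor.
-/

noncomputable section

namespace ConformalGeometry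

section KulkarniNomizu

variable {R V : Type*} [CommRing R] [AddCommGroup V] [Module R V]

/-- The Kulkarni–Nomizu product of the inner product `b` with the bilinear form `b (A ·, ·)`, one
index being raised so that it is an operator. The curvature of constant curvature is half of it for
`A = id`. -/
def kulkarniNomizu (b : V →ₗ[R] V →ₗ[R] R) (A : V →ₗ[R] V) (x y z : V) : V :=
  b (A y) z • x - b (A x) z • y + b y z • A x - b x z • A y

theorem kulkarniNomizu_add (b : V →ₗ[R] V →ₗ[R] R) (A B : V →ₗ[R] V) (x y z : V) :
    kulkarniNomizu b (A + B) x y z = kulkarniNomizu b A x y z + kulkarniNomizu b B x y z := by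
  simp only [kulkarniNomizu, LinearMap.add_apply, map_add]
  module

theorem kulkarniNomizu_smul_left (c : R) (b : V →ₗ[R] V →ₗ[R] R) (A : V →ₗ[R] V) (x y z : V) :
    kulkarniNomizu (c • b) A x y z = kulkarniNomizu b (c • A) x y z := by
  simp only [kulkarniNomizu, LinearMap.smul_apply, map_smul, smul_eq_mul]
  module

end KulkarniNomizu

section Frame

theorem sum_apply_smul_eq_self {K V ι : Type*} [Field K] [AddCommGroup V] [Module K V]
    [FiniteDimensional K V] [Fintype ι] [DecidableEq ι] (hι : Fintype.card ι = Module.finrank K V)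
    {b : V →ₗ[K] V →ₗ[K] K} {e : ι → V} (he : ∀ i j, b (e i) (e j) = if i = j then 1 else 0)
    (x : V) : ∑ k, b x (e k) • e k = x := by
  have hli : LinearIndependent K e := by
    refine Fintype.linearIndependent_iff.2 fun c hc i => ?_
    simpa [he] using congr(b $hc (e i))
  have hx : x ∈ Submodule.span K (Set.range e) :=
    hli.span_eq_top_of_card_eq_finrank' hι ▸ Submodule.mem_top
  obtain ⟨c, rfl⟩ := (Submodule.mem_span_range_iff_exists_fun K).1 hx
  simp [he]

variable {R V W ι κ : Type*} [CommRing R] [AddCommGroup V] [Module R V] [AddCommGroup W]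
  [Module R W] [Fintype ι] [Fintype κ] {b : V →ₗ[R] V →ₗ[R] R}

theorem sum_apply_frame_eq_smul {c : R} (hb : ∀ x y, b x y = b y x) {e : ι → V} {e' : κ → V}
    (he : ∀ x, ∑ i, b x (e i) • e i = x) (he' : ∀ x, ∑ k, (c • b) x (e' k) • e' k = x)
    (B : V →ₗ[R] V →ₗ[R] W) : ∑ i, B (e i) (e i) = c • ∑ k, B (e' k) (e' k) :=
  calc ∑ i, B (e i) (e i) = ∑ i, B (e i) (∑ k, (c • b) (e i) (e' k) • e' k) := by
        simp only [he']
    _ = c • ∑ k, B (∑ i, b (e' k) (e i) • e i) (e' k) := by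
        simp only [map_sum, map_smul, LinearMap.sum_apply, LinearMap.smul_apply, smul_eq_mul,
          Finset.smul_sum, mul_smul, hb (e _) (e' _)]
        exact Finset.sum_comm
    _ = c • ∑ k, B (e' k) (e' k) := by simp only [he]

theorem trace_eq_sum_frame [Module.Free R V] [Module.Finite R V] {e : ι → V}
    (he : ∀ x, ∑ i, b x (e i) • e i = x) (A : V →ₗ[R] V) :
    LinearMap.trace R V A = ∑ i, b (A (e i)) (e i) := by
  have hA : A = ∑ i, (b.flip (e i) ∘ₗ A).smulRight (e i) := by
    ext x
    simp [he]
  conv_lhs => rw [hA]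
  simp [LinearMap.trace_smulRight]

theorem sum_kulkarniNomizu_frame [Module.Free R V] [Module.Finite R V] {e : ι → V}
    (he : ∀ x, ∑ i, b x (e i) • e i = x) (A : V →ₗ[R] V) (x : V) :
    ∑ i, kulkarniNomizu b A x (e i) (e i)
      = ((Module.finrank R V : R) - 2) • A x + LinearMap.trace R V A • x := by
  have hA : ∑ i, b x (e i) • A (e i) = A x := by
    simpa only [map_sum, map_smul] using congr(A $(he x))
  simp only [kulkarniNomizu, Finset.sum_add_distrib, Finset.sum_sub_distrib, ← Finset.sum_smul,
    ← trace_eq_sum_frame he, hA, he]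
  have hid : ∑ i, b (e i) (e i) = Module.finrank R V := by
    rw [← LinearMap.trace_id, trace_eq_sum_frame he]
    rfl
  rw [hid]
  module

end Frame

section Connection

variable {𝕜 E : Type*} [NontriviallyNormedField 𝕜] [NormedAddCommGroup E] [NormedSpace 𝕜 E]

/-- The curvature operator of the connection with Christoffel symbols `Γ`; see
`chartCurvature_eq`. -/
def connectionCurvature (Γ : E → E →L[𝕜] E →L[𝕜] E) (y u v : E) : E →L[𝕜] E :=
  fderiv 𝕜 Γ y u v - fderiv 𝕜 Γ y v u + Γ y u ∘L Γ y v - Γ y v ∘L Γ y u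

/-- The covariant derivative `(∇_u D) (v, w)` of the vector-valued bilinear form `D` with respect to
the connection with Christoffel symbols `Γ`. -/
def covariantDeriv (Γ D : E → E →L[𝕜] E →L[𝕜] E) (y u v w : E) : E :=
  fderiv 𝕜 D y u v w + Γ y u (D y v w) - D y (Γ y u v) w - D y v (Γ y u w)

theorem connectionCurvature_add {Γ D : E → E →L[𝕜] E →L[𝕜] E} {y : E}
    (hΓ : DifferentiableAt 𝕜 Γ y) (hD : DifferentiableAt 𝕜 D y)
    (hsymm : ∀ u v, Γ y u v = Γ y v u) (u v w : E) :
    connectionCurvature (Γ + D) y u v w = connectionCurvature Γ y u v w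
      + (covariantDeriv Γ D y u v w - covariantDeriv Γ D y v u w)
      + (D y u (D y v w) - D y v (D y u w)) := by
  simp only [connectionCurvature, covariantDeriv, fderiv_add hΓ hD, Pi.add_apply, add_apply,
    sub_apply, ContinuousLinearMap.comp_apply, map_add, hsymm v u]
  abel

theorem hasFDerivAt_apply₂ {F G : Type*} [NormedAddCommGroup F] [NormedSpace 𝕜 F]
    [NormedAddCommGroup G] [NormedSpace 𝕜 G] {B : E → E →L[𝕜] F →L[𝕜] G} {y : E}
    (hB : DifferentiableAt 𝕜 B y) (v : E) (w : F) :
    HasFDerivAt (fun z => B z v w) (((fderiv 𝕜 B y).flip v).flip w) y := by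
  refine ((hB.hasFDerivAt.clm_apply (hasFDerivAt_const v y)).clm_apply
    (hasFDerivAt_const w y)).congr_fderiv ?_
  ext
  simp

theorem fderiv_apply_apply_comm {F : Type*} [NormedAddCommGroup F] [NormedSpace 𝕜 F]
    {B : E → E →L[𝕜] E →L[𝕜] F} {y : E} (hB : DifferentiableAt 𝕜 B y)
    (hsymm : ∀ᶠ z in nhds y, ∀ u v, B z u v = B z v u) (u v w : E) :
    fderiv 𝕜 B y u v w = fderiv 𝕜 B y u w v := by
  have h := (hasFDerivAt_apply₂ hB w v).congr_of_eventuallyEq (hsymm.mono fun z hz => hz v w)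
  simpa using congr($((hasFDerivAt_apply₂ hB v w).unique h) u)

theorem isInvertible_smul {F : Type*} [NormedAddCommGroup F] [NormedSpace 𝕜 F] {c : 𝕜}
    (hc : c ≠ 0) {A : E →L[𝕜] F} (hA : A.IsInvertible) : (c • A).IsInvertible := by
  obtain ⟨e, rfl⟩ := hA
  exact ⟨e.trans (ContinuousLinearEquiv.smulLeft (Units.mk0 c hc)), by ext; simp⟩

theorem eventually_isInvertible [CompleteSpace E] {F : Type*} [NormedAddCommGroup F]
    [NormedSpace 𝕜 F] {A : E → E →L[𝕜] F} {y : E} (hA : ContinuousAt A y)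
    (hy : (A y).IsInvertible) : ∀ᶠ z in nhds y, (A z).IsInvertible := by
  obtain ⟨e, he⟩ := hy
  have hnhds := e.nhds
  rw [he] at hnhds
  exact hA hnhds

theorem differentiableAt_inverse [CompleteSpace E] {F : Type*} [NormedAddCommGroup F]
    [NormedSpace 𝕜 F] {A : E → E →L[𝕜] F} {y : E} (hA : DifferentiableAt 𝕜 A y)
    (hy : (A y).IsInvertible) : DifferentiableAt 𝕜 (fun z => (A z).inverse) y :=
  (hy.contDiffAt_map_inverse.differentiableAt one_ne_zero).comp y hA

end Connection

section LeviCivita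

variable {E : Type*} [NormedAddCommGroup E] [NormedSpace ℝ E] {G : E → E →L[ℝ] E →L[ℝ] ℝ}
  {f : E → ℝ} {y : E}

theorem isInvertible_of_pos [FiniteDimensional ℝ E] {B : E →L[ℝ] E →L[ℝ] ℝ}
    (hB : ∀ u, u ≠ 0 → 0 < B u u) : B.IsInvertible := by
  have hinj : Function.Injective B := (injective_iff_map_eq_zero B).2 fun u hu => by
    by_contra hne
    exact (hB u hne).ne' (by simp [hu])
  have hfinrank : Module.finrank ℝ E = Module.finrank ℝ (E →L[ℝ] ℝ) := by
    rw [← (LinearMap.toContinuousLinearMap (𝕜 := ℝ) (E := E) (F' := ℝ)).finrank_eq,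
      Module.finrank_linearMap_self]
  exact ⟨(LinearMap.linearEquivOfInjective B.toLinearMap hinj hfinrank).toContinuousLinearEquiv,
    by ext; rfl⟩

theorem christoffel_symm (hG : DifferentiableAt ℝ G y)
    (hsymm : ∀ᶠ z in nhds y, ∀ u v, G z u v = G z v u) (u v : E) :
    christoffel G y u v = christoffel G y v u := by
  have hk : koszul G y u v = koszul G y v u := by
    ext w
    rw [koszul_apply, koszul_apply, fderiv_apply_apply_comm hG hsymm w u v]
    ring
  rw [christoffel_apply, christoffel_apply, hk]

theorem christoffel_metric_compatible (hG : DifferentiableAt ℝ G y)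
    (hsymm : ∀ᶠ z in nhds y, ∀ u v, G z u v = G z v u) (hinv : (G y).IsInvertible) (u v w : E) :
    fderiv ℝ G y u v w = G y (christoffel G y u v) w + G y v (christoffel G y u w) := by
  have huv := christoffel_spec G y hinv u v w
  have huw := christoffel_spec G y hinv u w v
  have hcomm := fderiv_apply_apply_comm hG hsymm
  rw [hcomm w u v, hcomm v u w] at huv
  rw [hcomm u w v, hcomm v u w, hcomm w u v] at huw
  rw [hsymm.self_of_nhds v (christoffel G y u w)]
  linarith

theorem differentiableAt_koszul (hG : ContDiffAt ℝ 2 G y) : DifferentiableAt ℝ (koszul G) y := by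
  have hdG : DifferentiableAt ℝ (fderiv ℝ G) y :=
    (hG.fderiv_right (m := 1) (by norm_num)).differentiableAt one_ne_zero
  have hflip : DifferentiableAt ℝ (fun z => (fderiv ℝ G z).flip) y :=
    (ContinuousLinearMap.flipₗᵢ ℝ E E (E →L[ℝ] ℝ)).differentiable.differentiableAt.comp y hdG
  exact (hdG.add hflip).sub ((differentiableAt_const _).clm_comp hflip)

theorem differentiableAt_christoffel [CompleteSpace E] (hG : ContDiffAt ℝ 2 G y)
    (hinv : (G y).IsInvertible) : DifferentiableAt ℝ (christoffel G) y := by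
  have hGinv := differentiableAt_inverse (hG.differentiableAt two_ne_zero) hinv
  have hcompL : DifferentiableAt ℝ
      (fun z => ContinuousLinearMap.compL ℝ E (E →L[ℝ] ℝ) E (G z).inverse) y :=
    (ContinuousLinearMap.compL ℝ E (E →L[ℝ] ℝ) E).differentiableAt.comp y hGinv
  exact (hcompL.clm_comp (differentiableAt_koszul hG)).const_smul (1 / 2 : ℝ)

/-- The gradient of `f` with respect to the metric `G`. -/
def metricGradient (G : E → E →L[ℝ] E →L[ℝ] ℝ) (f : E → ℝ) (y : E) : E :=
  (G y).inverse (fderiv ℝ f y)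

theorem metric_metricGradient (hinv : (G y).IsInvertible) (f : E → ℝ) :
    G y (metricGradient G f y) = fderiv ℝ f y :=
  hinv.self_apply_inverse _

theorem differentiableAt_metricGradient [CompleteSpace E] (hG : DifferentiableAt ℝ G y)
    (hinv : (G y).IsInvertible) (hf : DifferentiableAt ℝ (fderiv ℝ f) y) :
    DifferentiableAt ℝ (metricGradient G f) y :=
  (differentiableAt_inverse hG hinv).clm_apply hf

/-- The Hessian of `f` as the endomorphism `u ↦ ∇_u (grad f)`. -/
def hessianOperator (G : E → E →L[ℝ] E →L[ℝ] ℝ) (f : E → ℝ) (y : E) : E →L[ℝ] E :=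
  fderiv ℝ (metricGradient G f) y + (christoffel G y).flip (metricGradient G f y)

theorem metric_hessianOperator [CompleteSpace E] (hG : DifferentiableAt ℝ G y)
    (hsymm : ∀ᶠ z in nhds y, ∀ u v, G z u v = G z v u) (hinv : (G y).IsInvertible)
    (hf : DifferentiableAt ℝ (fderiv ℝ f) y) (u v : E) :
    G y (hessianOperator G f y u) v
      = fderiv ℝ (fderiv ℝ f) y u v - fderiv ℝ f y (christoffel G y u v) := by
  have hgrad := differentiableAt_metricGradient hG hinv hf
  have hdf : fderiv ℝ f =ᶠ[nhds y] fun z => G z (metricGradient G f z) :=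
    (eventually_isInvertible hG.continuousAt hinv).mono fun z hz =>
      (metric_metricGradient hz f).symm
  have hleibniz : fderiv ℝ (fderiv ℝ f) y u v
      = fderiv ℝ G y u (metricGradient G f y) v + G y (fderiv ℝ (metricGradient G f) y u) v := by
    rw [hdf.fderiv_eq, fderiv_clm_apply hG hgrad]
    simp [add_comm]
  rw [hleibniz, christoffel_metric_compatible hG hsymm hinv, ← metric_metricGradient hinv f]
  simp only [hessianOperator, add_apply, ContinuousLinearMap.flip_apply, map_add]
  ring

theorem metric_hessianOperator_comm [CompleteSpace E] (hG : DifferentiableAt ℝ G y)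
    (hsymm : ∀ᶠ z in nhds y, ∀ u v, G z u v = G z v u) (hinv : (G y).IsInvertible)
    (hf : ContDiffAt ℝ 2 f y) (u v : E) :
    G y (hessianOperator G f y u) v = G y (hessianOperator G f y v) u := by
  have hdf : DifferentiableAt ℝ (fderiv ℝ f) y :=
    (hf.fderiv_right (m := 1) (by norm_num)).differentiableAt one_ne_zero
  rw [metric_hessianOperator hG hsymm hinv hdf, metric_hessianOperator hG hsymm hinv hdf,
    (hf.isSymmSndFDerivAt (by simp)).eq u v, christoffel_symm hG hsymm]

end LeviCivita

section ConformalChange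

variable {E : Type*} [NormedAddCommGroup E] [NormedSpace ℝ E] {G : E → E →L[ℝ] E →L[ℝ] ℝ}
  {f : E → ℝ} {y : E}

/-- The difference of the Levi-Civita connections of `exp (2 f) G` and `G`, which is
`(u, v) ↦ df (u) v + df (v) u - G (u, v) grad f`. -/
def conformalDifference (G : E → E →L[ℝ] E →L[ℝ] ℝ) (f : E → ℝ) (y : E) : E →L[ℝ] E →L[ℝ] E :=
  (fderiv ℝ f y).smulRight (ContinuousLinearMap.id ℝ E)
    + ((fderiv ℝ f y).smulRight (ContinuousLinearMap.id ℝ E)).flip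
    - (ContinuousLinearMap.smulRightL ℝ E E).flip (metricGradient G f y) ∘L G y

theorem conformalDifference_apply (G : E → E →L[ℝ] E →L[ℝ] ℝ) (f : E → ℝ) (y u v : E) :
    conformalDifference G f y u v
      = fderiv ℝ f y u • v + fderiv ℝ f y v • u - G y u v • metricGradient G f y := by
  simp [conformalDifference]

theorem christoffel_conformal (hG : DifferentiableAt ℝ G y) (hf : DifferentiableAt ℝ f y)
    (hinv : (G y).IsInvertible) :
    christoffel (fun z => Real.exp (2 * f z) • G z) y
      = christoffel G y + conformalDifference G f y := by
  set a := Real.exp (2 * f y)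
  have hinv' : (a • G y).IsInvertible := isInvertible_smul (Real.exp_pos _).ne' hinv
  have hderiv : HasFDerivAt (fun z => Real.exp (2 * f z) • G z)
      (a • fderiv ℝ G y + (a • (2 : ℝ) • fderiv ℝ f y).smulRight (G y)) y :=
    ((hf.hasFDerivAt.const_mul 2).exp).smul hG.hasFDerivAt
  ext1 u; ext1 v
  apply hinv'.injective
  ext w
  have hkoszul' := christoffel_spec (fun z => Real.exp (2 * f z) • G z) y hinv' u v w
  have hkoszul := christoffel_spec G y hinv u v w
  rw [hderiv.fderiv] at hkoszul'
  simp only [add_apply, smul_apply, ContinuousLinearMap.smulRight_apply, smul_eq_mul, map_add,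
    map_sub, map_smul, sub_apply, conformalDifference_apply, metric_metricGradient hinv]
    at hkoszul' ⊢
  linear_combination (1 / 2) * hkoszul' - (a / 2) * hkoszul

theorem differentiableAt_conformalDifference [CompleteSpace E] (hG : DifferentiableAt ℝ G y)
    (hinv : (G y).IsInvertible) (hf : DifferentiableAt ℝ (fderiv ℝ f) y) :
    DifferentiableAt ℝ (conformalDifference G f) y := by
  have hgrad := differentiableAt_metricGradient hG hinv hf
  have hsmul : DifferentiableAt ℝ
      (fun z => (fderiv ℝ f z).smulRight (ContinuousLinearMap.id ℝ E)) y :=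
    ((ContinuousLinearMap.smulRightL ℝ E (E →L[ℝ] E)).flip
      (ContinuousLinearMap.id ℝ E)).differentiableAt.comp y hf
  have hflip : DifferentiableAt ℝ
      (fun z => ((fderiv ℝ f z).smulRight (ContinuousLinearMap.id ℝ E)).flip) y :=
    (ContinuousLinearMap.flipₗᵢ ℝ E E E).differentiable.differentiableAt.comp y hsmul
  have hgradL : DifferentiableAt ℝ
      (fun z => (ContinuousLinearMap.smulRightL ℝ E E).flip (metricGradient G f z)) y :=
    (ContinuousLinearMap.smulRightL ℝ E E).flip.differentiableAt.comp y hgrad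
  exact (hsmul.add hflip).sub (hgradL.clm_comp hG)

theorem fderiv_conformalDifference_apply [CompleteSpace E] (hG : DifferentiableAt ℝ G y)
    (hinv : (G y).IsInvertible) (hf : DifferentiableAt ℝ (fderiv ℝ f) y) (u v w : E) :
    fderiv ℝ (conformalDifference G f) y u v w
      = fderiv ℝ (fderiv ℝ f) y u v • w + fderiv ℝ (fderiv ℝ f) y u w • v
        - fderiv ℝ G y u v w • metricGradient G f y
        - G y v w • fderiv ℝ (metricGradient G f) y u := by
  have hdf (v : E) : HasFDerivAt (fun z => fderiv ℝ f z v) ((fderiv ℝ (fderiv ℝ f) y).flip v) y :=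
    (hf.hasFDerivAt.clm_apply (hasFDerivAt_const v y)).congr_fderiv (by ext; simp)
  have hformula := (((hdf v).smul_const w).add ((hdf w).smul_const v)).sub
    ((hasFDerivAt_apply₂ hG v w).smul
      (differentiableAt_metricGradient hG hinv hf).hasFDerivAt)
  have hD := (hasFDerivAt_apply₂ (differentiableAt_conformalDifference hG hinv hf) v
    w).congr_of_eventuallyEq
      (.of_forall fun z => (conformalDifference_apply G f z v w).symm)
  have heq := congr($(hD.unique hformula) u)
  simp only [ContinuousLinearMap.flip_apply, sub_apply, add_apply, smul_apply,
    ContinuousLinearMap.smulRight_apply] at heq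
  rw [heq]
  abel

theorem covariantDeriv_conformalDifference [CompleteSpace E] (hG : DifferentiableAt ℝ G y)
    (hsymm : ∀ᶠ z in nhds y, ∀ u v, G z u v = G z v u) (hinv : (G y).IsInvertible)
    (hf : DifferentiableAt ℝ (fderiv ℝ f) y) (u v w : E) :
    covariantDeriv (christoffel G) (conformalDifference G f) y u v w
      = G y (hessianOperator G f y u) v • w + G y (hessianOperator G f y u) w • v
        - G y v w • hessianOperator G f y u := by
  rw [covariantDeriv, fderiv_conformalDifference_apply hG hinv hf,
    christoffel_metric_compatible hG hsymm hinv, metric_hessianOperator hG hsymm hinv hf,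
    metric_hessianOperator hG hsymm hinv hf]
  simp only [conformalDifference_apply, hessianOperator, add_apply,
    ContinuousLinearMap.flip_apply, map_add, map_sub, map_smul]
  module

/-- The endomorphism `u ↦ df (u) grad f - ∇_u (grad f) - |grad f|² / 2 u`, by which the Schouten
operator changes from `G` to `exp (2 f) G`. -/
def schoutenChange (G : E → E →L[ℝ] E →L[ℝ] ℝ) (f : E → ℝ) (y : E) : E →L[ℝ] E :=
  (fderiv ℝ f y).smulRight (metricGradient G f y) - hessianOperator G f y
    - (fderiv ℝ f y (metricGradient G f y) / 2) • ContinuousLinearMap.id ℝ E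

theorem conformalDifference_commutator (hinv : (G y).IsInvertible)
    (hsymm : ∀ u v, G y u v = G y v u) (u v w : E) :
    conformalDifference G f y u (conformalDifference G f y v w)
        - conformalDifference G f y v (conformalDifference G f y u w)
      = kulkarniNomizu (G y).toLinearMap₁₂
          ((fderiv ℝ f y).smulRight (metricGradient G f y)
            - (fderiv ℝ f y (metricGradient G f y) / 2) • ContinuousLinearMap.id ℝ E).toLinearMap
          u v w := by
  have hgrad (a : E) : G y a (metricGradient G f y) = fderiv ℝ f y a := by
    rw [hsymm, metric_metricGradient hinv]
  simp only [conformalDifference_apply, kulkarniNomizu, map_add, map_sub, map_smul,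
    ContinuousLinearMap.toLinearMap₁₂_apply_apply_apply, ContinuousLinearMap.coe_coe,
    sub_apply, smul_apply, LinearMap.sub_apply, LinearMap.smul_apply,
    ContinuousLinearMap.smulRight_apply, ContinuousLinearMap.id_apply, smul_eq_mul,
    metric_metricGradient hinv, hgrad, hsymm v u]
  match_scalars <;> ring

theorem chartCurvature_conformal [CompleteSpace E] (hG : ContDiffAt ℝ 2 G y)
    (hf : ContDiffAt ℝ 2 f y) (hinv : (G y).IsInvertible)
    (hsymm : ∀ᶠ z in nhds y, ∀ u v, G z u v = G z v u) (u v w : E) :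
    chartCurvature (fun z => Real.exp (2 * f z) • G z) y u v w
      = chartCurvature G y u v w
        + kulkarniNomizu (G y).toLinearMap₁₂ (schoutenChange G f y).toLinearMap u v w := by
  have hdG : DifferentiableAt ℝ G y := hG.differentiableAt two_ne_zero
  have hddf : DifferentiableAt ℝ (fderiv ℝ f) y :=
    (hf.fderiv_right (m := 1) (by norm_num)).differentiableAt one_ne_zero
  have hΓ : christoffel (fun z => Real.exp (2 * f z) • G z)
      =ᶠ[nhds y] christoffel G + conformalDifference G f := by
    filter_upwards [eventually_isInvertible hdG.continuousAt hinv, hG.eventually (by simp),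
      hf.eventually (by simp)] with z hz hGz hfz
    exact christoffel_conformal (hGz.differentiableAt two_ne_zero)
      (hfz.differentiableAt two_ne_zero) hz
  have hcurv : chartCurvature (fun z => Real.exp (2 * f z) • G z) y u v w
      = connectionCurvature (christoffel G + conformalDifference G f) y u v w := by
    rw [chartCurvature, hΓ.fderiv_eq, hΓ.self_of_nhds, connectionCurvature]
  rw [hcurv, connectionCurvature_add (differentiableAt_christoffel hG hinv)
    (differentiableAt_conformalDifference hdG hinv hddf) (christoffel_symm hdG hsymm),
    conformalDifference_commutator hinv hsymm.self_of_nhds,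
    covariantDeriv_conformalDifference hdG hsymm hinv hddf,
    covariantDeriv_conformalDifference hdG hsymm hinv hddf,
    metric_hessianOperator_comm hdG hsymm hinv hf v u, chartCurvature, ← connectionCurvature]
  simp only [kulkarniNomizu, schoutenChange, ContinuousLinearMap.toLinearMap₁₂_apply_apply_apply,
    ContinuousLinearMap.coe_coe, sub_apply, LinearMap.sub_apply, map_sub]
  module

end ConformalChange
section PointwiseConformal

variable {m : ℕ} {M : Type*} [TopologicalSpace M] [ChartedSpace (EuclideanSpace ℝ (Fin m)) M]

instance finiteDimensional_tangentSpace (p : M) : FiniteDimensional ℝ (TangentSpace (𝓡 m) p) :=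
  inferInstanceAs (FiniteDimensional ℝ (EuclideanSpace ℝ (Fin m)))

theorem finrank_tangentSpace (p : M) : Module.finrank ℝ (TangentSpace (𝓡 m) p) = m :=
  finrank_euclideanSpace_fin (𝕜 := ℝ) (n := m)

variable [IsManifold (𝓡 m) ∞ M]

theorem sum_inner_smul_orthonormalFrame (g : RiemMetric m M) (p : M)
    (x : TangentSpace (𝓡 m) p) :
    ∑ k, (g.inner p).toLinearMap₁₂ x (orthonormalFrame g p k) • orthonormalFrame g p k = x :=
  sum_apply_smul_eq_self (by rw [Fintype.card_fin, finrank_tangentSpace])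
    (exists_orthonormalFrame g p).choose_spec x

theorem ricci_apply (g : RiemMetric m M) (p : M) (x : TangentSpace (𝓡 m) p) :
    ricci g p x = ∑ k, curvature g p x (orthonormalFrame g p k) (orthonormalFrame g p k) := by
  simp [ricci]

theorem scalarCurvature_eq_trace (g : RiemMetric m M) (p : M) :
    scalarCurvature g p = LinearMap.trace ℝ _ (ricci g p) :=
  (trace_eq_sum_frame (sum_inner_smul_orthonormalFrame g p) (ricci g p)).symm

/-- The Schouten operator, the Kulkarni–Nomizu factor of the difference between the curvature and
the Weyl curvature. -/
def schouten (g : RiemMetric m M) (p : M) : TangentSpace (𝓡 m) p →ₗ[ℝ] TangentSpace (𝓡 m) p :=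
  (1 / ((m : ℝ) - 2)) •
    (ricci g p - (scalarCurvature g p / (2 * ((m : ℝ) - 1))) • LinearMap.id)

theorem weyl_eq_curvature_sub (hm : 3 ≤ m) (g : RiemMetric m M) (p : M)
    (x y z : TangentSpace (𝓡 m) p) :
    weyl g p x y z
      = curvature g p x y z - kulkarniNomizu (g.inner p).toLinearMap₁₂ (schouten g p) x y z := by
  have hm' : (3 : ℝ) ≤ m := by exact_mod_cast hm
  have hm1 : (m : ℝ) - 1 ≠ 0 := by linarith
  have hm2 : (m : ℝ) - 2 ≠ 0 := by linarith
  simp only [weyl, tensorR0, tensorL, kulkarniNomizu, schouten, LinearMap.smul_apply,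
    LinearMap.sub_apply, LinearMap.id_apply, ContinuousLinearMap.toLinearMap₁₂_apply_apply_apply,
    map_sub, map_smul, smul_eq_mul]
  match_scalars <;> field_simp <;> ring

variable {g₁ g₂ : RiemMetric m M} {p : M} {a : ℝ}
  {A : TangentSpace (𝓡 m) p →ₗ[ℝ] TangentSpace (𝓡 m) p}

theorem ricci_conformal
    (h : (g₁.inner p).toLinearMap₁₂ = a • (g₂.inner p).toLinearMap₁₂)
    (hA : ∀ x y z, curvature g₁ p x y z
      = curvature g₂ p x y z + kulkarniNomizu (g₂.inner p).toLinearMap₁₂ A x y z) :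
    a • ricci g₁ p
      = ricci g₂ p + ((m : ℝ) - 2) • A + LinearMap.trace ℝ _ A • LinearMap.id := by
  ext1 x
  have hframe : ∑ k, curvature g₁ p x (orthonormalFrame g₂ p k) (orthonormalFrame g₂ p k)
      = a • ricci g₁ p x := by
    rw [ricci_apply]
    exact sum_apply_frame_eq_smul (g₂.symm p) (sum_inner_smul_orthonormalFrame g₂ p)
      (h ▸ sum_inner_smul_orthonormalFrame g₁ p) (curvature g₁ p x)
  rw [LinearMap.smul_apply, ← hframe]
  simp only [hA, Finset.sum_add_distrib, ← ricci_apply,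
    sum_kulkarniNomizu_frame (sum_inner_smul_orthonormalFrame g₂ p), finrank_tangentSpace,
    LinearMap.add_apply, LinearMap.smul_apply, LinearMap.id_apply, add_assoc]

theorem scalarCurvature_conformal
    (h : (g₁.inner p).toLinearMap₁₂ = a • (g₂.inner p).toLinearMap₁₂)
    (hA : ∀ x y z, curvature g₁ p x y z
      = curvature g₂ p x y z + kulkarniNomizu (g₂.inner p).toLinearMap₁₂ A x y z) :
    a * scalarCurvature g₁ p
      = scalarCurvature g₂ p + 2 * ((m : ℝ) - 1) * LinearMap.trace ℝ _ A := by
  have htrace := congr(LinearMap.trace ℝ _ $(ricci_conformal h hA))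
  simp only [map_add, map_smul, LinearMap.trace_id, finrank_tangentSpace, smul_eq_mul,
    ← scalarCurvature_eq_trace] at htrace
  linear_combination htrace

theorem schouten_conformal (hm : 3 ≤ m)
    (h : (g₁.inner p).toLinearMap₁₂ = a • (g₂.inner p).toLinearMap₁₂)
    (hA : ∀ x y z, curvature g₁ p x y z
      = curvature g₂ p x y z + kulkarniNomizu (g₂.inner p).toLinearMap₁₂ A x y z) :
    a • schouten g₁ p = schouten g₂ p + A := by
  have hm' : (3 : ℝ) ≤ m := by exact_mod_cast hm
  have hm1 : (m : ℝ) - 1 ≠ 0 := by linarith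
  have hm2 : (m : ℝ) - 2 ≠ 0 := by linarith
  rw [schouten, smul_comm, smul_sub, ricci_conformal h hA, smul_smul, ← mul_div_assoc,
    scalarCurvature_conformal h hA, schouten]
  match_scalars <;> field_simp
  ring

theorem weyl_eq_of_curvature_eq (hm : 3 ≤ m)
    (h : (g₁.inner p).toLinearMap₁₂ = a • (g₂.inner p).toLinearMap₁₂)
    (hA : ∀ x y z, curvature g₁ p x y z
      = curvature g₂ p x y z + kulkarniNomizu (g₂.inner p).toLinearMap₁₂ A x y z)
    (x y z : TangentSpace (𝓡 m) p) : weyl g₁ p x y z = weyl g₂ p x y z := by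
  rw [weyl_eq_curvature_sub hm, weyl_eq_curvature_sub hm, hA, h, kulkarniNomizu_smul_left,
    schouten_conformal hm h hA, kulkarniNomizu_add]
  abel

end PointwiseConformal

section Chart

variable {m : ℕ} {M : Type*} [TopologicalSpace M] [ChartedSpace (EuclideanSpace ℝ (Fin m)) M]
  [IsManifold (𝓡 m) ∞ M]

/-- The differential of the preferred chart at `p`, as an isomorphism from the tangent space to the
model space. -/
def tangentChart (p : M) : TangentSpace (𝓡 m) p ≃ₗ[ℝ] EuclideanSpace ℝ (Fin m) :=
  have : IsManifold (𝓡 m) 1 M := .of_le (n := ∞) (by simp)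
  .ofLinearMap
    (mfderiv (𝓡 m) 𝓘(ℝ, EuclideanSpace ℝ (Fin m)) (extChartAt (𝓡 m) p) p).toLinearMap
    (mfderiv 𝓘(ℝ, EuclideanSpace ℝ (Fin m)) (𝓡 m) (extChartAt (𝓡 m) p).symm
      (extChartAt (𝓡 m) p p)).toLinearMap
    (by
      have h := mfderiv_extChartAt_comp_mfderivWithin_extChartAt_symm' (I := 𝓡 m)
        (mem_extChartAt_source (I := 𝓡 m) p)
      rw [ModelWithCorners.Boundaryless.range_eq_univ, mfderivWithin_univ] at h
      exact congr(ContinuousLinearMap.toLinearMap $h))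
    (by
      have h := mfderivWithin_extChartAt_symm_comp_mfderiv_extChartAt' (I := 𝓡 m)
        (mem_extChartAt_source (I := 𝓡 m) p)
      rw [ModelWithCorners.Boundaryless.range_eq_univ, mfderivWithin_univ] at h
      exact congr(ContinuousLinearMap.toLinearMap $h))

theorem curvature_apply (g : RiemMetric m M) (p : M) (x y z : TangentSpace (𝓡 m) p) :
    curvature g p x y z
      = (tangentChart p).symm (chartCurvature (metricInChart g p) (extChartAt (𝓡 m) p p)
        (tangentChart p x) (tangentChart p y) (tangentChart p z)) :=
  rfl

theorem metricInChart_tangentChart (g : RiemMetric m M) (p : M) (x y : TangentSpace (𝓡 m) p) :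
    metricInChart g p (extChartAt (𝓡 m) p p) (tangentChart p x) (tangentChart p y)
      = g.inner p x y := by
  have hbase : ∀ q, q = p → ∀ u v : EuclideanSpace ℝ (Fin m),
      (g.inner q : EuclideanSpace ℝ (Fin m) →L[ℝ] EuclideanSpace ℝ (Fin m) →L[ℝ] ℝ) u v
        = (g.inner p : EuclideanSpace ℝ (Fin m) →L[ℝ] EuclideanSpace ℝ (Fin m) →L[ℝ] ℝ) u v := by
    rintro _ rfl _ _
    rfl
  refine (hbase _ (extChartAt_to_inv p) _ _).trans ?_
  exact congr(g.inner p $((tangentChart p).symm_apply_apply x)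
    $((tangentChart p).symm_apply_apply y))

theorem metricInChart_symm (g : RiemMetric m M) (p : M) (y u v : EuclideanSpace ℝ (Fin m)) :
    metricInChart g p y u v = metricInChart g p y v u :=
  g.symm _ _ _

theorem metricInChart_pos (g : RiemMetric m M) (p : M) {y u : EuclideanSpace ℝ (Fin m)}
    (hy : y ∈ (extChartAt (𝓡 m) p).target) (hu : u ≠ 0) : 0 < metricInChart g p y u u := by
  have : IsManifold (𝓡 m) 1 M := .of_le (n := ∞) (by simp)
  have hinv := isInvertible_mfderivWithin_extChartAt_symm hy
  rw [ModelWithCorners.Boundaryless.range_eq_univ, mfderivWithin_univ] at hinv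
  exact g.pos _ _ fun h0 => hu (hinv.injective (h0.trans (map_zero _).symm))

theorem contMDiffOn_mfderiv_extChartAt_symm {𝕜 F H N : Type*} [NontriviallyNormedField 𝕜]
    [NormedAddCommGroup F] [NormedSpace 𝕜 F] [TopologicalSpace H] {I : ModelWithCorners 𝕜 F H}
    [I.Boundaryless] [TopologicalSpace N] [ChartedSpace H N] [IsManifold I ∞ N] (p : N) (u : F) :
    ContMDiffOn 𝓘(𝕜, F) I.tangent ∞
      (fun y => (⟨(extChartAt I p).symm y, mfderiv 𝓘(𝕜, F) I (extChartAt I p).symm y u⟩ :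
        TangentBundle I N)) (extChartAt I p).target := by
  have hopen := isOpen_extChartAt_target (I := I) p
  have hconst : ContMDiffOn 𝓘(𝕜, F) 𝓘(𝕜, F).tangent ∞
      (fun y => (⟨y, u⟩ : TangentBundle 𝓘(𝕜, F) F)) (extChartAt I p).target := fun y _ =>
    contMDiffWithinAt_vectorSpace_iff_contDiffWithinAt.2 contDiffWithinAt_const
  have htangent := (contMDiffOn_extChartAt_symm (I := I) (n := ∞) p).contMDiffOn_tangentMapWithin
    (m := ∞) (by simp) hopen.uniqueMDiffOn
  refine (htangent.comp hconst fun y hy => hy).congr fun y hy => ?_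
  simp only [Function.comp_apply, tangentMapWithin, mfderivWithin_of_isOpen hopen hy]

theorem contDiffOn_metricInChart (g : RiemMetric m M) (p : M) :
    ContDiffOn ℝ ∞ (metricInChart g p) (extChartAt (𝓡 m) p).target := by
  refine contDiffOn_clm_apply.2 fun u => contDiffOn_clm_apply.2 fun v y hy => ?_
  have happly := ContMDiffWithinAt.clm_bundle_apply₂ (F₁ := EuclideanSpace ℝ (Fin m))
    (F₂ := EuclideanSpace ℝ (Fin m)) (F₃ := ℝ) (E₃ := Bundle.Trivial M ℝ)
    (g.contMDiff.contMDiffAt.comp_contMDiffWithinAt y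
      (contMDiffOn_extChartAt_symm (I := 𝓡 m) (n := ∞) p y hy))
    (contMDiffOn_mfderiv_extChartAt_symm p u y hy) (contMDiffOn_mfderiv_extChartAt_symm p v y hy)
  exact (Bundle.contMDiffWithinAt_totalSpace.1 happly).2.contDiffWithinAt

/-- The function `f` with `g₁ = exp (2 f) g₂` in the preferred chart at `p`, if `g₁ = α g₂`. -/
def logConformalFactor (α : M → ℝ) (p : M) (y : EuclideanSpace ℝ (Fin m)) : ℝ :=
  Real.log (α ((extChartAt (𝓡 m) p).symm y)) / 2

theorem contDiffAt_logConformalFactor {α : M → ℝ} (hα : ContMDiff (𝓡 m) 𝓘(ℝ, ℝ) ∞ α)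
    (hpos : ∀ p, 0 < α p) (p : M) :
    ContDiffAt ℝ ∞ (logConformalFactor (m := m) α p) (extChartAt (𝓡 m) p p) := by
  have hα' : ContDiffAt ℝ ∞ (fun y => α ((extChartAt (𝓡 m) p).symm y)) (extChartAt (𝓡 m) p p) :=
    ((hα.comp_contMDiffOn (contMDiffOn_extChartAt_symm (I := 𝓡 m) (n := ∞) p)).contMDiffAt
      (extChartAt_target_mem_nhds p)).contDiffAt
  exact (hα'.log (hpos _).ne').div_const 2

theorem metricInChart_conformal {g₁ g₂ : RiemMetric m M} {α : M → ℝ} (hpos : ∀ p, 0 < α p)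
    (h : ∀ (p : M) (x y : TangentSpace (𝓡 m) p), g₁.inner p x y = α p * g₂.inner p x y) (p : M) :
    metricInChart g₁ p
      = fun y => Real.exp (2 * logConformalFactor (m := m) α p y) • metricInChart g₂ p y := by
  ext y u v
  rw [logConformalFactor, mul_div_cancel₀ _ two_ne_zero, Real.exp_log (hpos _), smul_apply,
    smul_apply, metricInChart_apply, metricInChart_apply, h, smul_eq_mul]

theorem exists_curvature_eq_add_kulkarniNomizu {g₁ g₂ : RiemMetric m M} {α : M → ℝ}
    (hα : ContMDiff (𝓡 m) 𝓘(ℝ, ℝ) ∞ α) (hpos : ∀ p, 0 < α p)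
    (h : ∀ (p : M) (x y : TangentSpace (𝓡 m) p), g₁.inner p x y = α p * g₂.inner p x y) (p : M) :
    ∃ A : TangentSpace (𝓡 m) p →ₗ[ℝ] TangentSpace (𝓡 m) p, ∀ x y z, curvature g₁ p x y z
      = curvature g₂ p x y z + kulkarniNomizu (g₂.inner p).toLinearMap₁₂ A x y z := by
  set S := schoutenChange (metricInChart g₂ p) (logConformalFactor α p) (extChartAt (𝓡 m) p p)
  refine ⟨(tangentChart p).symm.toLinearMap ∘ₗ S.toLinearMap ∘ₗ (tangentChart p).toLinearMap,
    fun x y z => ?_⟩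
  have hchart := chartCurvature_conformal
    (((contDiffOn_metricInChart g₂ p).contDiffAt (extChartAt_target_mem_nhds p)).of_le
      (WithTop.coe_le_coe.2 le_top))
    ((contDiffAt_logConformalFactor hα hpos p).of_le (WithTop.coe_le_coe.2 le_top))
    (isInvertible_of_pos fun u => metricInChart_pos g₂ p (mem_extChartAt_target p))
    (.of_forall (metricInChart_symm g₂ p))
    (tangentChart p x) (tangentChart p y) (tangentChart p z)
  rw [curvature_apply, curvature_apply, metricInChart_conformal hpos h, hchart]
  simp only [kulkarniNomizu, map_add, map_sub, map_smul, LinearEquiv.symm_apply_apply,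
    ContinuousLinearMap.toLinearMap₁₂_apply_apply_apply, ← metricInChart_tangentChart,
    LinearMap.comp_apply, LinearEquiv.coe_coe, LinearEquiv.apply_symm_apply, S]

end Chart

section ConformalOsserman

theorem eigenspace_smul {K V : Type*} [Field K] [AddCommGroup V] [Module K V]
    (T : Module.End K V) {c : K} (hc : c ≠ 0) (μ : K) :
    (c • T).eigenspace (c * μ) = T.eigenspace μ := by
  ext x
  rw [Module.End.mem_eigenspace_iff, Module.End.mem_eigenspace_iff, LinearMap.smul_apply, mul_smul]
  exact smul_right_inj hc

variable {m : ℕ} {M : Type*} [TopologicalSpace M] [ChartedSpace (EuclideanSpace ℝ (Fin m)) M]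
  [IsManifold (𝓡 m) ∞ M] {g₁ g₂ : RiemMetric m M}

theorem weyl_conformal (hm : 3 ≤ m) (h : ConformallyEquivalent g₁ g₂) (p : M)
    (x y z : TangentSpace (𝓡 m) p) : weyl g₁ p x y z = weyl g₂ p x y z := by
  obtain ⟨α, hα, hpos, hg⟩ := h
  obtain ⟨A, hA⟩ := exists_curvature_eq_add_kulkarniNomizu hα hpos hg p
  exact weyl_eq_of_curvature_eq hm (LinearMap.ext₂ (hg p)) hA x y z

theorem conformalJacobi_conformal (hm : 3 ≤ m) (h : ConformallyEquivalent g₁ g₂) (p : M)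
    (x : TangentSpace (𝓡 m) p) : conformalJacobi g₁ p x = conformalJacobi g₂ p x :=
  LinearMap.ext fun y => weyl_conformal hm h p y x x

theorem conformalJacobi_smul (g : RiemMetric m M) (p : M) (c : ℝ) (x : TangentSpace (𝓡 m) p) :
    conformalJacobi g p (c • x) = c ^ 2 • conformalJacobi g p x := by
  ext y
  change weyl g p y (c • x) (c • x) = c ^ 2 • weyl g p y x x
  simp only [weyl, tensorR0, tensorL, map_smul, LinearMap.smul_apply, smul_apply, smul_eq_mul]
  module

theorem ConformallyEquivalent.symm (h : ConformallyEquivalent g₁ g₂) :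
    ConformallyEquivalent g₂ g₁ := by
  obtain ⟨α, hα, hpos, hg⟩ := h
  refine ⟨fun p => (α p)⁻¹, hα.inv₀ fun p => (hpos p).ne', fun p => inv_pos.2 (hpos p),
    fun p x y => ?_⟩
  rw [hg, inv_mul_cancel_left₀ (hpos p).ne']

theorem ConformallyEquivalent.exists_smul_unit (h : ConformallyEquivalent g₁ g₂) (p : M) :
    ∃ c : ℝ, c ≠ 0 ∧ ∀ x : TangentSpace (𝓡 m) p, g₂.inner p x x = 1 →
      g₁.inner p (c • x) (c • x) = 1 := by
  obtain ⟨α, -, hpos, hg⟩ := h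
  have hα := hpos p
  refine ⟨(√(α p))⁻¹, by positivity, fun x hx => ?_⟩
  simp only [hg, map_smul, smul_apply, smul_eq_mul, hx]
  rw [mul_one, ← mul_assoc, ← mul_inv, Real.mul_self_sqrt hα.le, inv_mul_cancel₀ hα.ne']

theorem IsConformallyOsserman.of_conformallyEquivalent (hm : 3 ≤ m)
    (h : ConformallyEquivalent g₁ g₂) (h₁ : IsConformallyOsserman g₁) :
    IsConformallyOsserman g₂ := by
  intro p x y hx hy μ
  obtain ⟨c, hc, hunit⟩ := h.exists_smul_unit p
  have hJ (x : TangentSpace (𝓡 m) p) : (conformalJacobi g₁ p (c • x)).eigenspace (c ^ 2 * μ)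
      = (conformalJacobi g₂ p x).eigenspace μ := by
    rw [conformalJacobi_smul, eigenspace_smul _ (pow_ne_zero 2 hc), conformalJacobi_conformal hm h]
  rw [← hJ, ← hJ]
  exact h₁ p _ _ (hunit x hx) (hunit y hy) _

end ConformalOsserman

end ConformalGeometry

end

theorem theorem1p2 {m : ℕ} (hm : 3 ≤ m) {M : Type*} [TopologicalSpace M]
    [ChartedSpace (EuclideanSpace ℝ (Fin m)) M] [IsManifold (𝓡 m) ∞ M]
    (g₁ g₂ : ConformalGeometry.RiemMetric m M)
    (h : ConformalGeometry.ConformallyEquivalent g₁ g₂) :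
    ConformalGeometry.IsConformallyOsserman g₁ ↔ ConformalGeometry.IsConformallyOsserman g₂ :=
  ⟨ConformalGeometry.IsConformallyOsserman.of_conformallyEquivalent hm h,
    ConformalGeometry.IsConformallyOsserman.of_conformallyEquivalent hm h.symm⟩
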